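/- Let $m,n$ be nonnegative integers, let $A,B$ be complex $m\times n$ matrices, let $2\le p<\infty$ and let $1\le k\le n$ be an integer. Let $\sigma_1(A)\ge\sigma_2(A)\ge\cdots\ge\sigma_{\min(m,n)}(A)\ge 0$ denote the singular values of $A$, with $\sigma_i(A)=0$ for $i>\min(m,n)$, and let $$\|A\|_{(p,k)}=\bigl(\sigma_1^p(A)+\cdots+\sigma_k^p(A)\bigr)^{1/p}$$ be the Ky Fan $p$-$k$ norm. Then $A$ is Birkhoff–James orthogonal to $B$ in this norm, that is, $$\|A+\lambda B\|_{(p,k)}\ge\|A\|_{(p,k)}\quad\text{for all }\lambda\in\mathbb{C},$$ if and only if there exist $k$ orthonormal vectors $v_1,\ldots,v_k\in\mathbb{C}^n$ satisfying $$A^*Av_i=\sigma_i^2(A)\,v_i\quad\text{for all }1\le i\le k$$ such that $$\sum_{i=1}^{k}\bigl\langle (A^*A)^{\frac{p-2}{2}}A^*B\,v_i,\,v_i\bigr\rangle=0,$$ where $\langle\cdot,\cdot\rangle$ is the standard inner product of $\mathbb{C}^n$, the power of the positive semidefinite matrix $A^*A$ is taken by functional calculus, and $(A^*A)^0=I$.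 -/

import Mathlib

open scoped Matrix MatrixOrder

/-- The `i`-th singular value of a complex matrix, in non-increasing order, indexed from `0`: it is
the square root of the `i`-th largest eigenvalue of `Aᴴ * A`, and `0` for `i ≥ min m n`. -/
noncomputable def matrixSingularValue {m n : ℕ} (A : Matrix (Fin m) (Fin n) ℂ) (i : ℕ) : ℝ :=
  (Matrix.toEuclideanLin A).singularValues i

/-- The Ky Fan `p`-`k` norm: the `ℓᵖ` norm of the `k` largest singular values. -/
noncomputable def kyFanNorm {m n : ℕ} (p : ℝ) (k : ℕ) (A : Matrix (Fin m) (Fin n) ℂ) : ℝ :=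
  (∑ i ∈ Finset.range k, matrixSingularValue A i ^ p) ^ (1 / p)

/-- Birkhoff–James orthogonality of `A` to `B` with respect to the Ky Fan `p`-`k` norm. -/
def KyFanBirkhoffJamesOrthogonal {m n : ℕ} (p : ℝ) (k : ℕ) (A B : Matrix (Fin m) (Fin n) ℂ) :
    Prop :=
  ∀ z : ℂ, kyFanNorm p k A ≤ kyFanNorm p k (A + z • B)

open Filter Topology
open InnerProductSpace (rankOne)
open scoped ComplexConjugate InnerProduct InnerProductSpace

/-!
For a minimum of `K (T + z S)` at `z = 0`, where `K X = ∑ i < k, σᵢ(X) ^ p`, the obstruction to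
differentiating `K` is that the leading right singular vectors of `T` need not be unique. The
orthonormal choices of them correspond to the idempotents of a face `𝓕` of the convex hull of the
rank-`k` projections, namely the maximizers of `H ↦ re tr (T†T H)` over `0 ≤ H ≤ 1`, `tr H = k`.

Put `Φ X = (X†X)^((p-2)/2) X†`. Young's inequality
`‖a‖^(p-2) re ⟪a, b⟫ ≤ (1 - 1/p) ‖a‖^p + (1/p) ‖b‖^p`, summed over a frame of right singular vectors
of `X` with projection `P`, gives `re tr (Φ X Y P) ≤ (1 - 1/p) K X + (1/p) K Y`, with equality for
`Y = X`; the sum of the `‖Y vᵢ‖^p` is at most `K Y` by Jensen's inequality, as `2 ≤ p`, and Ky Fan's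
maximum principle. For `X = T` and `Y = T + z S` this proves sufficiency. For necessity take
`X = T + t z S`, `Y = T` and let `t → 0`: every `z` admits some `H ∈ 𝓕` with
`0 ≤ re (z tr (Φ T S H))`. As `𝓕` is convex and compact, separation yields `H ∈ 𝓕` with
`tr (Φ T S H) = 0`.

An extreme point of the set of these `H` is idempotent. Otherwise, as `tr H` is an integer, two of
its eigenvalues lie strictly between `0` and `1`; the traceless Hermitian operators on the plane of
their eigenvectors have real dimension three, so a nonzero one is annihilated by the complex
functional `tr (Φ T S ·)`, and `H` can be moved along it in both directions.
-/

section WeightedSums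

variable {n k : ℕ} {g : ℕ → ℝ} {c : Fin n → ℝ}

theorem sum_range_sub_sum_mul (hkn : k ≤ n) (hc : ∑ j, c j = k) (τ : ℝ) :
    ∑ i ∈ Finset.range k, g i - ∑ j, c j * g j =
      ∑ j : Fin n, ((if (j : ℕ) < k then 1 else 0) - c j) * (g j - τ) := by
  have hsum (f : ℕ → ℝ) :
      ∑ j : Fin n, (if (j : ℕ) < k then 1 else 0) * f j = ∑ i ∈ Finset.range k, f i := by
    rw [Fin.sum_univ_eq_sum_range (fun i => (if i < k then 1 else 0) * f i)]
    simp only [ite_mul, one_mul, zero_mul, ← Finset.sum_filter]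
    congr 1
    ext i
    simp only [Finset.mem_filter, Finset.mem_range]
    omega
  have hcount : ∑ j : Fin n, (if (j : ℕ) < k then (1 : ℝ) else 0) = k := by
    simpa using hsum fun _ => 1
  simp only [sub_mul, mul_sub, Finset.sum_sub_distrib, hsum, ← Finset.sum_mul, hc, hcount]
  ring

theorem indicator_sub_mul_sub_nonneg (hg : Antitone g) {a : ℝ} (ha : a ∈ Set.Icc 0 1) (j : ℕ) :
    0 ≤ ((if j < k then 1 else 0) - a) * (g j - g (k - 1)) := by
  split_ifs with hj
  · exact mul_nonneg (sub_nonneg.2 ha.2) (sub_nonneg.2 (hg (by omega)))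
  · exact mul_nonneg_of_nonpos_of_nonpos (by linarith [ha.1]) (sub_nonpos.2 (hg (by omega)))

theorem le_of_sum_eq_of_mem_Icc (hc01 : ∀ j, c j ∈ Set.Icc 0 1) (hc : ∑ j, c j = k) : k ≤ n := by
  have : ∑ j, c j ≤ ∑ _j : Fin n, 1 := Finset.sum_le_sum fun j _ => (hc01 j).2
  simpa [hc] using this

theorem sum_mul_le_sum_range (hg : Antitone g) (hc01 : ∀ j, c j ∈ Set.Icc 0 1)
    (hc : ∑ j, c j = k) : ∑ j, c j * g j ≤ ∑ i ∈ Finset.range k, g i := by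
  rw [← sub_nonneg, sum_range_sub_sum_mul (le_of_sum_eq_of_mem_Icc hc01 hc) hc (g (k - 1))]
  exact Finset.sum_nonneg fun j _ => indicator_sub_mul_sub_nonneg hg (hc01 j) j

theorem eq_indicator_of_sum_mul_eq_sum_range (hg : Antitone g) (hc01 : ∀ j, c j ∈ Set.Icc 0 1)
    (hc : ∑ j, c j = k) (h : ∑ j, c j * g j = ∑ i ∈ Finset.range k, g i) {j : Fin n}
    (hj : g j ≠ g (k - 1)) : c j = if (j : ℕ) < k then 1 else 0 := by
  have hkn := le_of_sum_eq_of_mem_Icc hc01 hc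
  have hzero := sum_range_sub_sum_mul (g := g) hkn hc (g (k - 1))
  rw [h, sub_self, eq_comm, Finset.sum_eq_zero_iff_of_nonneg
    fun j _ => indicator_sub_mul_sub_nonneg hg (hc01 j) j] at hzero
  have := (mul_eq_zero.1 (hzero j (Finset.mem_univ j))).resolve_right (sub_ne_zero.2 hj)
  exact (sub_eq_zero.1 this).symm

theorem eq_zero_or_one_of_sum_eq_natCast {ι : Type*} [Fintype ι] {h : ι → ℝ}
    (h01 : ∀ i, h i ∈ Set.Icc 0 1) (hsum : ∑ i, h i = k)
    (hfrac : ∀ i j, h i ∈ Set.Ioo 0 1 → h j ∈ Set.Ioo 0 1 → i = j) (i : ι) :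
    h i = 0 ∨ h i = 1 := by
  classical
  by_contra! hi
  have hi' : h i ∈ Set.Ioo 0 1 := ⟨(h01 i).1.lt_of_ne' hi.1, (h01 i).2.lt_of_ne hi.2⟩
  have hrest : ∀ j ∈ Finset.univ.erase i, h j = ((if h j = 1 then 1 else 0 : ℤ) : ℝ) := by
    intro j hj
    split_ifs with h1
    · simpa using h1
    · by_contra h0
      rw [Int.cast_zero] at h0
      exact (Finset.ne_of_mem_erase hj)
        (hfrac j i ⟨(h01 j).1.lt_of_ne' h0, (h01 j).2.lt_of_ne h1⟩ hi')
  rw [← Finset.add_sum_erase _ _ (Finset.mem_univ i), Finset.sum_congr rfl hrest,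
    ← Int.cast_sum] at hsum
  set N : ℤ := ∑ j ∈ Finset.univ.erase i, if h j = 1 then 1 else 0
  have hiN : h i = ((k - N : ℤ) : ℝ) := by
    push_cast
    linarith
  rw [hiN] at hi'
  have h0 : (0 : ℤ) < k - N := by exact_mod_cast hi'.1
  have h1 : (k - N : ℤ) < 1 := by exact_mod_cast hi'.2
  omega

end WeightedSums

theorem zero_mem_of_forall_exists_re_mul_nonneg {K : Set ℂ} (hconv : Convex ℝ K)
    (hclosed : IsClosed K) (h : ∀ z : ℂ, ∃ w ∈ K, 0 ≤ (z * w).re) : 0 ∈ K := by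
  by_contra h0
  obtain ⟨f, u, hu, hf⟩ := RCLike.geometric_hahn_banach_point_closed (𝕜 := ℂ) hconv hclosed h0
  obtain ⟨w, hw, hw0⟩ := h (-f 1)
  have hfw : f w = f 1 * w := by
    rw [mul_comm, ← smul_eq_mul, ← map_smul, smul_eq_mul, mul_one]
  have := hf w hw
  rw [neg_mul, Complex.neg_re] at hw0
  simp only [map_zero, hfw, RCLike.re_to_complex] at hu this
  linarith

section Young

variable {𝕜 F : Type*} [RCLike 𝕜] [NormedAddCommGroup F] [InnerProductSpace 𝕜 F] {p : ℝ}

theorem norm_rpow_sub_two_mul_re_inner_self (hp : p ≠ 0) (a : F) :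
    ‖a‖ ^ (p - 2) * RCLike.re (inner 𝕜 a a) = ‖a‖ ^ p := by
  rw [inner_self_eq_norm_sq]
  rcases eq_or_ne a 0 with rfl | ha
  · simp [Real.zero_rpow hp]
  · rw [← Real.rpow_natCast, ← Real.rpow_add (norm_pos_iff.2 ha)]
    norm_num

theorem norm_rpow_sub_two_mul_re_inner_le (hp : 1 < p) (a b : F) :
    ‖a‖ ^ (p - 2) * RCLike.re (inner 𝕜 a b) ≤ (1 - 1 / p) * ‖a‖ ^ p + 1 / p * ‖b‖ ^ p := by
  have hp1 : 0 < p - 1 := by linarith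
  have hpq : Real.HolderConjugate (p / (p - 1)) p :=
    Real.holderConjugate_iff.2 ⟨by rw [lt_div_iff₀ hp1]; linarith, by field_simp; ring⟩
  have hcs : ‖a‖ ^ (p - 2) * RCLike.re (inner 𝕜 a b) ≤ ‖a‖ ^ (p - 1) * ‖b‖ := by
    rcases eq_or_ne a 0 with rfl | ha
    · simp [Real.zero_rpow hp1.ne']
    · calc ‖a‖ ^ (p - 2) * RCLike.re (inner 𝕜 a b) ≤ ‖a‖ ^ (p - 2) * (‖a‖ * ‖b‖) := by
            gcongr
            exact re_inner_le_norm a b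
        _ = ‖a‖ ^ (p - 1) * ‖b‖ := by
            rw [← mul_assoc, ← Real.rpow_add_one (norm_pos_iff.2 ha).ne']
            congr 2
            ring
  calc ‖a‖ ^ (p - 2) * RCLike.re (inner 𝕜 a b) ≤ ‖a‖ ^ (p - 1) * ‖b‖ := hcs
    _ ≤ (‖a‖ ^ (p - 1)) ^ (p / (p - 1)) / (p / (p - 1)) + ‖b‖ ^ p / p :=
      Real.young_inequality_of_nonneg (by positivity) (norm_nonneg b) hpq
    _ = (1 - 1 / p) * ‖a‖ ^ p + 1 / p * ‖b‖ ^ p := by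
      rw [← Real.rpow_mul (norm_nonneg a), mul_div_cancel₀ _ hp1.ne']
      field_simp

end Young

section TraceMul

variable {E : Type*} [NormedAddCommGroup E] [InnerProductSpace ℂ E] [FiniteDimensional ℂ E]

/-- The complex-linear functional `H ↦ tr (M H)` on operators; every linear functional is of this
form. -/
noncomputable def traceMul (M : E →L[ℂ] E) : (E →L[ℂ] E) →L[ℂ] ℂ :=
  (LinearMap.trace ℂ E ∘ₗ ContinuousLinearMap.coeLM ℂ).toContinuousLinearMap ∘L
    ContinuousLinearMap.mul ℂ (E →L[ℂ] E) M

theorem traceMul_eq_trace (M H : E →L[ℂ] E) :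
    traceMul M H = LinearMap.trace ℂ E (M * H : E →L[ℂ] E) := rfl

theorem traceMul_one (H : E →L[ℂ] E) : traceMul 1 H = LinearMap.trace ℂ E H := rfl

theorem traceMul_eq_sum {ι : Type*} [Fintype ι] (b : OrthonormalBasis ι ℂ E) (M H : E →L[ℂ] E) :
    traceMul M H = ∑ j, ⟪b j, M (H (b j))⟫_ℂ :=
  LinearMap.trace_eq_sum_inner _ b

theorem traceMul_rankOne (M : E →L[ℂ] E) (x y : E) : traceMul M (rankOne ℂ x y) = ⟪y, M x⟫_ℂ := by
  rw [traceMul_eq_trace, ContinuousLinearMap.mul_def, InnerProductSpace.comp_rankOne,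
    InnerProductSpace.trace_rankOne]

theorem traceMul_comp_add_smul {F : Type*} [NormedAddCommGroup F] [NormedSpace ℂ F]
    (M : F →L[ℂ] E) (T S : E →L[ℂ] F) (z : ℂ) (H : E →L[ℂ] E) :
    traceMul (M ∘L (T + z • S)) H = traceMul (M ∘L T) H + z * traceMul (M ∘L S) H := by
  rw [ContinuousLinearMap.comp_add, ContinuousLinearMap.comp_smul, traceMul_eq_trace, add_mul,
    smul_mul_assoc, ContinuousLinearMap.toLinearMap_add, ContinuousLinearMap.toLinearMap_smul,
    map_add, map_smul]
  rfl

theorem tendsto_traceMul {ι : Type*} {l : Filter ι} {Ms Hs : ι → E →L[ℂ] E} {M H : E →L[ℂ] E}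
    (hM : Tendsto Ms l (𝓝 M)) (hH : Tendsto Hs l (𝓝 H)) :
    Tendsto (fun t => traceMul (Ms t) (Hs t)) l (𝓝 (traceMul M H)) :=
  ((LinearMap.trace ℂ E ∘ₗ
    ContinuousLinearMap.coeLM ℂ).continuous_of_finiteDimensional.tendsto _).comp (hM.mul hH)

end TraceMul

section FractionalProjections

variable {E : Type*} [NormedAddCommGroup E] [InnerProductSpace ℂ E]

variable (E) in
/-- The convex hull of the orthogonal projections of rank `k`, described without projections: the
operators of trace `k` between `0` and `1` in the Loewner order. -/
def fractionalProjections (k : ℕ) : Set (E →L[ℂ] E) :=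
  Set.Icc 0 1 ∩ {H | LinearMap.trace ℂ E H = k}

variable {k : ℕ} {H : E →L[ℂ] E}

theorem re_inner_map_self_mem_Icc_of_mem_Icc (hH : H ∈ Set.Icc 0 1) (x : E) :
    (⟪x, H x⟫_ℂ).re ∈ Set.Icc 0 (‖x‖ ^ 2) := by
  have h0 := ((ContinuousLinearMap.nonneg_iff_isPositive H).1 hH.1).re_inner_nonneg_right x
  have h1 := ((ContinuousLinearMap.le_def H 1).1 hH.2).re_inner_nonneg_right x
  rw [sub_apply, inner_sub_right, map_sub, one_apply_eq_self, inner_self_eq_norm_sq] at h1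
  exact ⟨h0, sub_nonneg.1 h1⟩

theorem isSymmetric_of_nonneg (hH : 0 ≤ H) : (H : E →ₗ[ℂ] E).IsSymmetric :=
  ((ContinuousLinearMap.nonneg_iff_isPositive H).1 hH).isSymmetric

variable [FiniteDimensional ℂ E]

theorem convex_fractionalProjections : Convex ℝ (fractionalProjections E k) := by
  have : CompleteSpace E := FiniteDimensional.complete ℂ E
  refine ((convex_Ici 0).inter (convex_Iic 1)).inter ?_
  exact (convex_singleton (k : ℂ)).linear_preimage
    ((traceMul (1 : E →L[ℂ] E)).toLinearMap.restrictScalars ℝ)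

theorem isCompact_fractionalProjections : IsCompact (fractionalProjections E k) := by
  have : CompleteSpace E := FiniteDimensional.complete ℂ E
  have : ProperSpace (E →L[ℂ] E) := FiniteDimensional.proper ℂ _
  refine (isCompact_closedBall (0 : E →L[ℂ] E) 1).of_isClosed_subset ?_ ?_
  · exact isClosed_Icc.inter (isClosed_eq (traceMul 1).continuous continuous_const)
  · rintro H ⟨hH, -⟩
    rw [mem_closedBall_zero_iff]
    exact (CStarAlgebra.mem_Icc_iff_norm_le_one.1 hH).2

/-- The operator `∑ i, vᵢ vᵢ*`; for an orthonormal family `v` it is the orthogonal projection onto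
the span of `v`. -/
noncomputable def frameProjection {ι : Type*} [Fintype ι] (v : ι → E) : E →L[ℂ] E :=
  ∑ i, rankOne ℂ (v i) (v i)

theorem traceMul_frameProjection {ι : Type*} [Fintype ι] (M : E →L[ℂ] E) (v : ι → E) :
    traceMul M (frameProjection v) = ∑ i, ⟪v i, M (v i)⟫_ℂ := by
  simp only [frameProjection, map_sum, traceMul_rankOne]

theorem frameProjection_mem_fractionalProjections {v : Fin k → E} (hv : Orthonormal ℂ v) :
    frameProjection v ∈ fractionalProjections E k := by
  have hpos : (frameProjection v).IsPositive :=
    ContinuousLinearMap.isPositive_sum _ fun i _ => InnerProductSpace.isPositive_rankOne_self (v i)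
  refine ⟨⟨(ContinuousLinearMap.nonneg_iff_isPositive _).2 hpos, ?_⟩, ?_⟩
  · rw [ContinuousLinearMap.le_def, ContinuousLinearMap.isPositive_def]
    refine ⟨ContinuousLinearMap.isPositive_one.isSymmetric.sub hpos.isSymmetric, fun x => ?_⟩
    have hx : (⟪frameProjection v x, x⟫_ℂ).re = ∑ i, ‖⟪v i, x⟫_ℂ‖ ^ 2 := by
      rw [frameProjection, sum_apply, sum_inner, Complex.re_sum]
      refine Finset.sum_congr rfl fun i _ => ?_
      rw [InnerProductSpace.inner_left_rankOne_apply, ← RCLike.re_to_complex,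
        inner_mul_symm_re_eq_norm, norm_mul, norm_inner_symm, sq]
    have := hv.sum_inner_products_le x (s := Finset.univ)
    rw [ContinuousLinearMap.reApplyInnerSelf_apply, sub_apply, inner_sub_left, map_sub,
      one_apply_eq_self, inner_self_eq_norm_sq, RCLike.re_to_complex, hx]
    linarith
  · rw [Set.mem_ofPred_eq, ← traceMul_one, traceMul_frameProjection]
    simp [inner_self_eq_norm_sq_to_K, hv.1]

end FractionalProjections

section PlanePerturbation

variable {E : Type*} [NormedAddCommGroup E] [InnerProductSpace ℂ E] {a b : E}

/-- The traceless symmetric operators on the plane spanned by an orthonormal pair `a`, `b`: in that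
basis, `planePerturbation a b (r, z)` has the matrix with diagonal `r`, `-r` and upper right entry
`z`. -/
noncomputable def planePerturbation (a b : E) : ℝ × ℂ →ₗ[ℝ] E →L[ℂ] E where
  toFun c := (c.1 : ℂ) • (rankOne ℂ a a - rankOne ℂ b b) + c.2 • rankOne ℂ a b +
    conj c.2 • rankOne ℂ b a
  map_add' c d := by
    simp only [Prod.fst_add, Prod.snd_add, map_add, Complex.ofReal_add]
    module
  map_smul' r c := by
    simp only [Prod.smul_fst, Prod.smul_snd, Complex.real_smul, map_mul, Complex.conj_ofReal,
      smul_eq_mul, RingHom.id_apply, Complex.ofReal_mul]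
    module

theorem planePerturbation_eq (a b : E) (c : ℝ × ℂ) :
    planePerturbation a b c = (c.1 : ℂ) • (rankOne ℂ a a - rankOne ℂ b b) + c.2 • rankOne ℂ a b +
      conj c.2 • rankOne ℂ b a := rfl

theorem planePerturbation_apply (a b : E) (c : ℝ × ℂ) (x : E) :
    planePerturbation a b c x = (c.1 * ⟪a, x⟫_ℂ + c.2 * ⟪b, x⟫_ℂ) • a +
      (conj c.2 * ⟪a, x⟫_ℂ - c.1 * ⟪b, x⟫_ℂ) • b := by
  simp only [planePerturbation_eq, add_apply, smul_apply, sub_apply,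
    InnerProductSpace.rankOne_apply]
  module

theorem isSymmetric_planePerturbation (a b : E) (c : ℝ × ℂ) :
    (planePerturbation a b c : E →ₗ[ℂ] E).IsSymmetric := by
  intro x y
  simp only [ContinuousLinearMap.coe_coe, planePerturbation_apply, inner_add_left, inner_add_right,
    inner_smul_left, inner_smul_right, map_add, map_sub, map_mul, inner_conj_symm,
    Complex.conj_ofReal, Complex.conj_conj]
  ring

theorem abs_re_inner_planePerturbation_le (a b : E) (c : ℝ × ℂ) (x : E) :
    |(⟪x, planePerturbation a b c x⟫_ℂ).re| ≤
      (|c.1| + ‖c.2‖) * (‖⟪a, x⟫_ℂ‖ ^ 2 + ‖⟪b, x⟫_ℂ‖ ^ 2) := by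
  have hcoord (z w α β γ : ℂ) : ‖(z * α + w * β) * γ‖ ≤ (‖z‖ * ‖α‖ + ‖w‖ * ‖β‖) * ‖γ‖ := by
    rw [norm_mul]
    gcongr
    exact (norm_add_le _ _).trans_eq (by rw [norm_mul, norm_mul])
  have hnorm : ‖⟪x, planePerturbation a b c x⟫_ℂ‖ ≤
      (|c.1| * ‖⟪a, x⟫_ℂ‖ + ‖c.2‖ * ‖⟪b, x⟫_ℂ‖) * ‖⟪a, x⟫_ℂ‖ +
        (‖c.2‖ * ‖⟪a, x⟫_ℂ‖ + |c.1| * ‖⟪b, x⟫_ℂ‖) * ‖⟪b, x⟫_ℂ‖ := by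
    rw [planePerturbation_apply, inner_add_right, inner_smul_right, inner_smul_right,
      sub_eq_add_neg, ← neg_mul]
    refine (norm_add_le _ _).trans (add_le_add ?_ ?_)
    · simpa [norm_inner_symm x] using hcoord c.1 c.2 ⟪a, x⟫_ℂ ⟪b, x⟫_ℂ ⟪x, a⟫_ℂ
    · simpa [norm_inner_symm x] using hcoord (conj c.2) (-c.1) ⟪a, x⟫_ℂ ⟪b, x⟫_ℂ ⟪x, b⟫_ℂ
  refine (Complex.abs_re_le_norm _).trans (hnorm.trans ?_)
  linarith [mul_nonneg (norm_nonneg c.2) (sq_nonneg (‖⟪a, x⟫_ℂ‖ - ‖⟪b, x⟫_ℂ‖))]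

theorem trace_planePerturbation [FiniteDimensional ℂ E] (hnorm : ‖a‖ = ‖b‖)
    (hab : ⟪a, b⟫_ℂ = 0) (c : ℝ × ℂ) : LinearMap.trace ℂ E (planePerturbation a b c) = 0 := by
  rw [← traceMul_one, planePerturbation_eq]
  simp [traceMul_rankOne, hab, inner_eq_zero_symm.1 hab, inner_self_eq_norm_sq_to_K, hnorm]

theorem eq_zero_of_planePerturbation_eq_zero (ha : ‖a‖ = 1) (hb : ‖b‖ = 1) (hab : ⟪a, b⟫_ℂ = 0)
    {c : ℝ × ℂ} (h : planePerturbation a b c = 0) : c = 0 := by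
  have hba : ⟪b, a⟫_ℂ = 0 := inner_eq_zero_symm.1 hab
  have hdiag : ⟪a, planePerturbation a b c a⟫_ℂ = c.1 := by
    rw [planePerturbation_apply, inner_add_right, inner_smul_right, inner_smul_right, hab, hba,
      inner_self_eq_norm_sq_to_K, ha]
    simp
  have hoffdiag : ⟪a, planePerturbation a b c b⟫_ℂ = c.2 := by
    rw [planePerturbation_apply, inner_add_right, inner_smul_right, inner_smul_right, hab,
      inner_self_eq_norm_sq_to_K, inner_self_eq_norm_sq_to_K, ha, hb]
    simp
  rw [h, zero_apply, inner_zero_right, eq_comm] at hdiag hoffdiag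
  exact Prod.ext (Complex.ofReal_eq_zero.1 hdiag) hoffdiag

end PlanePerturbation

section ExtremePoints

variable {E : Type*} [NormedAddCommGroup E] [InnerProductSpace ℂ E] {k : ℕ} {H : E →L[ℂ] E}

theorem re_inner_map_self_eq_sum {ι : Type*} [Fintype ι] {u : OrthonormalBasis ι ℂ E} {h : ι → ℝ}
    (hu : ∀ j, H (u j) = (h j : ℂ) • u j) (x : E) :
    (⟪x, H x⟫_ℂ).re = ∑ j, h j * ‖⟪u j, x⟫_ℂ‖ ^ 2 := by
  conv_lhs => enter [1, 3]; rw [← u.sum_repr' x, map_sum]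
  rw [inner_sum, Complex.re_sum]
  refine Finset.sum_congr rfl fun j _ => ?_
  rw [map_smul, hu, smul_comm, inner_smul_right, inner_smul_right, Complex.re_ofReal_mul,
    ← RCLike.re_to_complex, inner_mul_symm_re_eq_norm, norm_mul, norm_inner_symm, sq]

variable {ι : Type*} [Fintype ι] {u : OrthonormalBasis ι ℂ E} {h : ι → ℝ}
  (hu : ∀ j, H (u j) = (h j : ℂ) • u j)

include hu

theorem eigenvalue_eq_re_inner (j : ι) : h j = (⟪u j, H (u j)⟫_ℂ).re := by
  rw [hu, inner_smul_right, inner_self_eq_norm_sq_to_K, u.norm_eq_one]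
  simp

theorem eigenvalue_mem_Icc_of_mem_Icc (hH : H ∈ Set.Icc 0 1) (j : ι) : h j ∈ Set.Icc 0 1 := by
  rw [eigenvalue_eq_re_inner hu]
  simpa using re_inner_map_self_mem_Icc_of_mem_Icc hH (u j)

theorem nonneg_add_planePerturbation (h0 : 0 ≤ H) {i j : ι} (hij : i ≠ j) {c : ℝ × ℂ}
    (hi : |c.1| + ‖c.2‖ ≤ h i) (hj : |c.1| + ‖c.2‖ ≤ h j) :
    0 ≤ H + planePerturbation (u i) (u j) c := by
  have hpos := (ContinuousLinearMap.nonneg_iff_isPositive H).1 h0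
  rw [ContinuousLinearMap.nonneg_iff_isPositive, ContinuousLinearMap.isPositive_def]
  refine ⟨hpos.isSymmetric.add (isSymmetric_planePerturbation _ _ _), fun x => ?_⟩
  have hnonneg (l : ι) : 0 ≤ h l := by
    rw [eigenvalue_eq_re_inner hu]
    exact hpos.re_inner_nonneg_right (u l)
  have hHx : h i * ‖⟪u i, x⟫_ℂ‖ ^ 2 + h j * ‖⟪u j, x⟫_ℂ‖ ^ 2 ≤ (⟪x, H x⟫_ℂ).re := by
    rw [re_inner_map_self_eq_sum hu]
    exact Finset.add_le_sum (f := fun l => h l * ‖⟪u l, x⟫_ℂ‖ ^ 2)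
      (fun l _ => mul_nonneg (hnonneg l) (sq_nonneg _)) (Finset.mem_univ i) (Finset.mem_univ j) hij
  have hKx := (abs_le.1 (abs_re_inner_planePerturbation_le (u i) (u j) c x)).1
  rw [ContinuousLinearMap.reApplyInnerSelf_apply, inner_re_symm, add_apply, inner_add_right,
    map_add, RCLike.re_to_complex, RCLike.re_to_complex]
  linarith [mul_le_mul_of_nonneg_right hi (sq_nonneg ‖⟪u i, x⟫_ℂ‖),
    mul_le_mul_of_nonneg_right hj (sq_nonneg ‖⟪u j, x⟫_ℂ‖)]

theorem add_planePerturbation_mem_fractionalProjections [FiniteDimensional ℂ E]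
    (hH : H ∈ fractionalProjections E k) {i j : ι}
    (hij : i ≠ j) {c : ℝ × ℂ} (hi : |c.1| + ‖c.2‖ ≤ min (h i) (1 - h i))
    (hj : |c.1| + ‖c.2‖ ≤ min (h j) (1 - h j)) :
    H + planePerturbation (u i) (u j) c ∈ fractionalProjections E k := by
  obtain ⟨⟨h0, h1⟩, htr⟩ := hH
  have hu' (l : ι) : (1 - H) (u l) = ((1 - h l : ℝ) : ℂ) • u l := by
    rw [sub_apply, one_apply_eq_self, hu, Complex.ofReal_sub, Complex.ofReal_one, sub_smul,
      one_smul]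
  have hcneg : |(-c).1| + ‖(-c).2‖ = |c.1| + ‖c.2‖ := by simp
  have hlower := nonneg_add_planePerturbation hu h0 hij (hi.trans (min_le_left _ _))
    (hj.trans (min_le_left _ _))
  have hupper := nonneg_add_planePerturbation hu' (sub_nonneg.2 h1) hij (c := -c)
    (hcneg.trans_le (hi.trans (min_le_right _ _))) (hcneg.trans_le (hj.trans (min_le_right _ _)))
  rw [map_neg, ← sub_eq_add_neg, sub_sub] at hupper
  refine ⟨⟨hlower, sub_nonneg.1 hupper⟩, ?_⟩
  rw [Set.mem_ofPred_eq, ContinuousLinearMap.toLinearMap_add, map_add,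
    trace_planePerturbation ((u.norm_eq_one i).trans (u.norm_eq_one j).symm)
    (u.orthonormal.2 hij), add_zero]
  exact htr

omit hu in
theorem exists_ne_zero_traceMul_planePerturbation_eq_zero [FiniteDimensional ℂ E] (M : E →L[ℂ] E)
    (a b : E) {δ : ℝ} (hδ : 0 < δ) :
    ∃ c : ℝ × ℂ, c ≠ 0 ∧ |c.1| + ‖c.2‖ ≤ δ ∧ traceMul M (planePerturbation a b c) = 0 := by
  obtain ⟨c, hc, hc0⟩ := (Submodule.ne_bot_iff _).1 (LinearMap.ker_ne_bot_of_finrank_lt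
    (f := (traceMul M).toLinearMap.restrictScalars ℝ ∘ₗ planePerturbation a b)
    (by simp [Complex.finrank_real_complex]))
  have hpos : 0 < |c.1| + ‖c.2‖ := by
    by_contra! hle
    have h1 : |c.1| = 0 := by linarith [abs_nonneg c.1, norm_nonneg c.2]
    have h2 : ‖c.2‖ = 0 := by linarith [abs_nonneg c.1, norm_nonneg c.2]
    exact hc0 (Prod.ext (abs_eq_zero.1 h1) (norm_eq_zero.1 h2))
  have hε : 0 < δ / (|c.1| + ‖c.2‖) := div_pos hδ hpos
  refine ⟨(δ / (|c.1| + ‖c.2‖)) • c, smul_ne_zero hε.ne' hc0, le_of_eq ?_, ?_⟩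
  · rw [Prod.smul_fst, Prod.smul_snd, norm_smul, smul_eq_mul, abs_mul, Real.norm_eq_abs,
      abs_of_pos hε, ← mul_add, div_mul_cancel₀ _ hpos.ne']
  · have hc' : traceMul M (planePerturbation a b c) = 0 := hc
    rw [map_smul, ContinuousLinearMap.map_smul_of_tower, hc', smul_zero]

theorem eq_of_fractional_of_mem_extremePoints [FiniteDimensional ℂ E] {S : Set (E →L[ℂ] E)}
    (hS : IsExtreme ℝ (fractionalProjections E k) S) {M : E →L[ℂ] E} {w : ℂ}
    (hH : H ∈ (S ∩ {K | traceMul M K = w}).extremePoints ℝ) {i j : ι}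
    (hi : h i ∈ Set.Ioo 0 1) (hj : h j ∈ Set.Ioo 0 1) : i = j := by
  by_contra hij
  obtain ⟨⟨hHS, hHw⟩, hext⟩ := mem_extremePoints.1 hH
  set δ := min (min (h i) (1 - h i)) (min (h j) (1 - h j))
  have hδ : 0 < δ := lt_min (lt_min hi.1 (sub_pos.2 hi.2)) (lt_min hj.1 (sub_pos.2 hj.2))
  obtain ⟨c, hc0, hcδ, hcM⟩ :=
    exists_ne_zero_traceMul_planePerturbation_eq_zero M (u i) (u j) hδ
  set K := planePerturbation (u i) (u j) c with hK
  have hmem (c' : ℝ × ℂ) (hc' : |c'.1| + ‖c'.2‖ ≤ δ) :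
      H + planePerturbation (u i) (u j) c' ∈ fractionalProjections E k :=
    add_planePerturbation_mem_fractionalProjections hu (hS.subset hHS) hij
      (hc'.trans (min_le_left _ _)) (hc'.trans (min_le_right _ _))
  have hadd : H + K ∈ fractionalProjections E k := hmem c hcδ
  have hsub : H - K ∈ fractionalProjections E k := by
    simpa [hK, sub_eq_add_neg] using hmem (-c) (by simpa using hcδ)
  have hseg : H ∈ openSegment ℝ (H + K) (H - K) :=
    ⟨1 / 2, 1 / 2, by norm_num, by norm_num, by norm_num, by module⟩
  have hHK := hext (H + K) ⟨hS.left_mem_of_mem_openSegment hadd hsub hHS hseg,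
    by rw [Set.mem_ofPred_eq, map_add, hcM, add_zero]; exact hHw⟩ (H - K)
    ⟨hS.right_mem_of_mem_openSegment hadd hsub hHS hseg,
    by rw [Set.mem_ofPred_eq, map_sub, hcM, sub_zero]; exact hHw⟩ hseg
  exact hc0 (eq_zero_of_planePerturbation_eq_zero (u.norm_eq_one i) (u.norm_eq_one j)
    (u.orthonormal.2 hij) (add_eq_left.1 hHK.1))

omit hu in
theorem isIdempotentElem_of_eigenvalue (hu : ∀ j, H (u j) = (h j : ℂ) • u j)
    (h01 : ∀ j, h j = 0 ∨ h j = 1) : IsIdempotentElem H := by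
  refine ContinuousLinearMap.coe_injective (u.toBasis.ext fun j => ?_)
  rcases h01 j with hj | hj <;> simp [hu, hj]

omit hu in
theorem exists_isIdempotentElem_traceMul_eq [FiniteDimensional ℂ E] {S : Set (E →L[ℂ] E)}
    (hS : IsExtreme ℝ (fractionalProjections E k) S) (hScomp : IsCompact S) (M : E →L[ℂ] E)
    (hH : H ∈ S) : ∃ P ∈ S, IsIdempotentElem P ∧ traceMul M P = traceMul M H := by
  have hslice : IsCompact (S ∩ {K | traceMul M K = traceMul M H}) :=
    hScomp.inter_right (isClosed_eq (traceMul M).continuous continuous_const)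
  obtain ⟨P, hP⟩ := hslice.extremePoints_nonempty ⟨H, hH, rfl⟩
  obtain ⟨hPS, hPM⟩ := extremePoints_subset hP
  obtain ⟨hP01, hPtr : LinearMap.trace ℂ E P = k⟩ := hS.subset hPS
  have hsymm := isSymmetric_of_nonneg hP01.1
  set u := hsymm.eigenvectorBasis rfl
  set h := hsymm.eigenvalues rfl
  have hu (j) : P (u j) = (h j : ℂ) • u j := hsymm.apply_eigenvectorBasis rfl j
  have hsum : ∑ j, h j = k := by
    simpa [hPtr, h] using (congrArg Complex.re (hsymm.trace_eq_sum_eigenvalues rfl)).symm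
  exact ⟨P, hPS, isIdempotentElem_of_eigenvalue hu (eq_zero_or_one_of_sum_eq_natCast
    (eigenvalue_mem_Icc_of_mem_Icc hu hP01) hsum
    fun i j => eq_of_fractional_of_mem_extremePoints hu hS hP), hPM⟩

end ExtremePoints

section KyFanFace

variable {E : Type*} [NormedAddCommGroup E] [InnerProductSpace ℂ E]

theorem map_eq_smul_of_forall_inner_eq_zero {ι : Type*} [Fintype ι] {G : E →L[ℂ] E}
    {e : OrthonormalBasis ι ℂ E} {g : ι → ℝ} (hG : ∀ j, G (e j) = (g j : ℂ) • e j) {τ : ℝ} {x : E}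
    (hx : ∀ j, g j ≠ τ → ⟪e j, x⟫_ℂ = 0) : G x = (τ : ℂ) • x := by
  rw [← e.sum_repr' x, map_sum, Finset.smul_sum]
  refine Finset.sum_congr rfl fun j _ => ?_
  rw [map_smul, hG, smul_comm]
  rcases eq_or_ne (g j) τ with hj | hj
  · rw [hj]
  · rw [hx j hj, zero_smul, smul_zero, smul_zero]

variable {n k : ℕ} {G H P : E →L[ℂ] E}

theorem re_inner_map_self_mem_Icc_zero_one (e : OrthonormalBasis (Fin n) ℂ E)
    (hH : H ∈ fractionalProjections E k) (j : Fin n) :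
    (⟪e j, H (e j)⟫_ℂ).re ∈ Set.Icc 0 1 := by
  simpa using re_inner_map_self_mem_Icc_of_mem_Icc hH.1 (e j)

variable [FiniteDimensional ℂ E]

/-- The face of `fractionalProjections E k` on which `H ↦ re tr (G H)` is maximal. -/
def kyFanFace (G : E →L[ℂ] E) (k : ℕ) : Set (E →L[ℂ] E) :=
  {H ∈ fractionalProjections E k |
    ∀ K ∈ fractionalProjections E k, (traceMul G K).re ≤ (traceMul G H).re}

theorem isExposed_kyFanFace (G : E →L[ℂ] E) (k : ℕ) :
    IsExposed ℝ (fractionalProjections E k) (kyFanFace G k) :=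
  fun _ => ⟨Complex.reCLM ∘L (traceMul G).restrictScalars ℝ, rfl⟩

theorem mem_kyFanFace_of_tendsto {ι : Type*} {l : Filter ι} [l.NeBot] {Gs Hs : ι → E →L[ℂ] E}
    (hG : Tendsto Gs l (𝓝 G)) (hH : Tendsto Hs l (𝓝 H))
    (h : ∀ t, Hs t ∈ kyFanFace (Gs t) k) : H ∈ kyFanFace G k := by
  have hlim {Ks : ι → E →L[ℂ] E} {K : E →L[ℂ] E} (hK : Tendsto Ks l (𝓝 K)) :
      Tendsto (fun t => (traceMul (Gs t) (Ks t)).re) l (𝓝 (traceMul G K).re) :=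
    (Complex.continuous_re.tendsto _).comp (tendsto_traceMul hG hK)
  exact ⟨isCompact_fractionalProjections.isClosed.mem_of_tendsto hH (.of_forall fun t => (h t).1),
    fun K hK => le_of_tendsto_of_tendsto' (hlim tendsto_const_nhds) (hlim hH)
      fun t => (h t).2 K hK⟩

variable {e : OrthonormalBasis (Fin n) ℂ E} {g : ℕ → ℝ}

theorem sum_re_inner_eq_natCast (e : OrthonormalBasis (Fin n) ℂ E)
    (hH : H ∈ fractionalProjections E k) : ∑ j, (⟪e j, H (e j)⟫_ℂ).re = k := by
  obtain ⟨-, htr : LinearMap.trace ℂ E H = k⟩ := hH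
  rw [← traceMul_one, traceMul_eq_sum e] at htr
  simpa using congrArg Complex.re htr

theorem re_traceMul_eq_sum (hG : ∀ j : Fin n, G (e j) = (g j : ℂ) • e j) :
    (traceMul G H).re = ∑ j, (⟪e j, H (e j)⟫_ℂ).re * g j := by
  rw [traceMul_eq_trace, ContinuousLinearMap.toLinearMap_mul, LinearMap.trace_mul_comm,
    LinearMap.trace_eq_sum_inner _ e, Complex.re_sum]
  refine Finset.sum_congr rfl fun j _ => ?_
  rw [Module.End.mul_apply, ContinuousLinearMap.coe_coe, ContinuousLinearMap.coe_coe, hG, map_smul,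
    inner_smul_right, Complex.re_ofReal_mul, mul_comm]

theorem re_traceMul_le_sum_range (hG : ∀ j : Fin n, G (e j) = (g j : ℂ) • e j) (hg : Antitone g)
    (hH : H ∈ fractionalProjections E k) :
    (traceMul G H).re ≤ ∑ i ∈ Finset.range k, g i := by
  rw [re_traceMul_eq_sum hG]
  exact sum_mul_le_sum_range hg (re_inner_map_self_mem_Icc_zero_one e hH)
    (sum_re_inner_eq_natCast e hH)

theorem re_traceMul_frameProjection {v : Fin k → E} (hv : Orthonormal ℂ v)
    (hGv : ∀ i : Fin k, G (v i) = (g i : ℂ) • v i) :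
    (traceMul G (frameProjection v)).re = ∑ i ∈ Finset.range k, g i := by
  rw [traceMul_frameProjection, Complex.re_sum, ← Fin.sum_univ_eq_sum_range]
  refine Finset.sum_congr rfl fun i _ => ?_
  rw [hGv, inner_smul_right, inner_self_eq_norm_sq_to_K, hv.1]
  simp

theorem mem_kyFanFace_of_sum_range_le (hG : ∀ j : Fin n, G (e j) = (g j : ℂ) • e j)
    (hg : Antitone g) (hH : H ∈ fractionalProjections E k)
    (h : ∑ i ∈ Finset.range k, g i ≤ (traceMul G H).re) : H ∈ kyFanFace G k :=
  ⟨hH, fun _ hK => (re_traceMul_le_sum_range hG hg hK).trans h⟩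

theorem re_traceMul_eq_sum_range (hG : ∀ j : Fin n, G (e j) = (g j : ℂ) • e j)
    (hg : Antitone g) (hH : H ∈ kyFanFace G k) :
    (traceMul G H).re = ∑ i ∈ Finset.range k, g i := by
  have hkn : k ≤ n := le_of_sum_eq_of_mem_Icc (re_inner_map_self_mem_Icc_zero_one e hH.1)
    (sum_re_inner_eq_natCast e hH.1)
  have hv : Orthonormal ℂ (e ∘ Fin.castLE hkn) :=
    e.orthonormal.comp _ (Fin.castLE_injective hkn)
  refine (re_traceMul_le_sum_range hG hg hH.1).antisymm ?_
  rw [← re_traceMul_frameProjection hv fun i => hG (Fin.castLE hkn i)]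
  exact hH.2 _ (frameProjection_mem_fractionalProjections hv)

theorem re_inner_map_self_eq_indicator (hG : ∀ j : Fin n, G (e j) = (g j : ℂ) • e j)
    (hg : Antitone g) (hH : H ∈ kyFanFace G k) {j : Fin n} (hj : g j ≠ g (k - 1)) :
    (⟪e j, H (e j)⟫_ℂ).re = if (j : ℕ) < k then 1 else 0 :=
  eq_indicator_of_sum_mul_eq_sum_range hg (re_inner_map_self_mem_Icc_zero_one e hH.1)
    (sum_re_inner_eq_natCast e hH.1)
    ((re_traceMul_eq_sum hG).symm.trans (re_traceMul_eq_sum_range hG hg hH)) hj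

theorem exists_starProjection_eq_of_isIdempotentElem (hP : P ∈ fractionalProjections E k)
    (hPi : IsIdempotentElem P) :
    ∃ U : Submodule ℂ E, P = U.starProjection ∧ Module.finrank ℂ U = k := by
  have : CompleteSpace E := FiniteDimensional.complete ℂ E
  obtain ⟨⟨h0, -⟩, htr : LinearMap.trace ℂ E P = k⟩ := hP
  have hsa : IsSelfAdjoint P :=
    ((ContinuousLinearMap.nonneg_iff_isPositive P).1 h0).isSelfAdjoint
  obtain ⟨U, hU, hPU⟩ := isStarProjection_iff_eq_starProjection.1 ⟨hPi, hsa⟩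
  refine ⟨U, hPU, ?_⟩
  have hproj : LinearMap.IsProj U (P : E →ₗ[ℂ] E) := by
    rw [hPU]
    exact ⟨U.starProjection_apply_mem, fun x hx => Submodule.starProjection_eq_self_iff.2 hx⟩
  rw [hproj.trace] at htr
  exact_mod_cast htr

variable {U : Submodule ℂ E}

theorem mem_of_re_inner_starProjection_eq {x : E}
    (h : (⟪x, U.starProjection x⟫_ℂ).re = ‖x‖ ^ 2) : x ∈ U := by
  rw [← RCLike.re_to_complex, inner_re_symm, U.re_inner_starProjection_eq_normSq,
    sq_eq_sq₀ (norm_nonneg _) (norm_nonneg _)] at h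
  exact (U.mem_iff_norm_starProjection x).2 h

theorem mem_orthogonal_of_re_inner_starProjection_eq_zero {x : E}
    (h : (⟪x, U.starProjection x⟫_ℂ).re = 0) : x ∈ Uᗮ := by
  rw [← RCLike.re_to_complex, inner_re_symm, U.re_inner_starProjection_eq_normSq, sq_eq_zero_iff,
    norm_eq_zero] at h
  exact Submodule.orthogonalProjectionOnto_eq_zero_iff.1 h

theorem mem_of_starProjection_mem_kyFanFace (hG : ∀ j : Fin n, G (e j) = (g j : ℂ) • e j)
    (hg : Antitone g) (hU : U.starProjection ∈ kyFanFace G k) {j : Fin n} (hjk : j < k)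
    (hj : g j ≠ g (k - 1)) : e j ∈ U :=
  mem_of_re_inner_starProjection_eq <| by
    rw [re_inner_map_self_eq_indicator hG hg hU hj, if_pos hjk, e.norm_eq_one, one_pow]

theorem mem_orthogonal_of_starProjection_mem_kyFanFace
    (hG : ∀ j : Fin n, G (e j) = (g j : ℂ) • e j) (hg : Antitone g)
    (hU : U.starProjection ∈ kyFanFace G k) {j : Fin n} (hkj : k ≤ j) (hj : g j ≠ g (k - 1)) :
    e j ∈ Uᗮ :=
  mem_orthogonal_of_re_inner_starProjection_eq_zero <| by
    rw [re_inner_map_self_eq_indicator hG hg hU hj, if_neg hkj.not_gt]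

theorem exists_orthonormalBasis_coe_eq {e' : Fin k → E} (he' : Orthonormal ℂ e')
    (hU : Module.finrank ℂ U = k) {s : Set (Fin k)} (hs : ∀ i ∈ s, e' i ∈ U) :
    ∃ b : OrthonormalBasis (Fin k) ℂ U, ∀ i ∈ s, (b i : E) = e' i := by
  have hproj {i : Fin k} (hi : i ∈ s) : (U.orthogonalProjectionOnto (e' i) : E) = e' i :=
    Submodule.starProjection_eq_self_iff.2 (hs i hi)
  have hv : Orthonormal ℂ (s.domRestrict fun i => U.orthogonalProjectionOnto (e' i)) := by
    rw [← U.subtypeₗᵢ.orthonormal_comp_iff]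
    convert he'.comp ((↑) : s → Fin k) Subtype.val_injective using 1
    exact funext fun i => hproj i.2
  obtain ⟨b, hb⟩ := hv.exists_orthonormalBasis_extension_of_card_eq
    (hU.trans (Fintype.card_fin k).symm)
  exact ⟨b, fun i hi => by rw [hb i hi, hproj hi]⟩

theorem exists_orthonormal_eq_frameProjection (hG : ∀ j : Fin n, G (e j) = (g j : ℂ) • e j)
    (hg : Antitone g) (hP : P ∈ kyFanFace G k) (hPi : IsIdempotentElem P) :
    ∃ v : Fin k → E, Orthonormal ℂ v ∧ (∀ i : Fin k, G (v i) = (g i : ℂ) • v i) ∧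
      P = frameProjection v := by
  have hkn : k ≤ n := le_of_sum_eq_of_mem_Icc (re_inner_map_self_mem_Icc_zero_one e hP.1)
    (sum_re_inner_eq_natCast e hP.1)
  obtain ⟨U, rfl, hU⟩ := exists_starProjection_eq_of_isIdempotentElem hP.1 hPi
  obtain ⟨b, hb⟩ := exists_orthonormalBasis_coe_eq
    (e.orthonormal.comp _ (Fin.castLE_injective hkn)) hU (s := {i | g i ≠ g (k - 1)})
    fun i hi => mem_of_starProjection_mem_kyFanFace hG hg hP i.2 hi
  have hborth : Orthonormal ℂ fun i => (b i : E) :=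
    U.subtypeₗᵢ.orthonormal_comp_iff.2 b.orthonormal
  refine ⟨fun i => b i, hborth, fun i => ?_, b.starProjection_eq_sum_rankOne⟩
  by_cases hi : g i = g (k - 1)
  · rw [hi]
    refine map_eq_smul_of_forall_inner_eq_zero hG fun j hj => ?_
    rcases lt_or_ge (j : ℕ) k with hjk | hkj
    · have hbj : (b ⟨j, hjk⟩ : E) = e j := hb ⟨j, hjk⟩ hj
      rw [← hbj]
      exact hborth.2 fun h => hj (by rw [← hi, ← h])
    · exact (Submodule.mem_orthogonal' U (e j)).1
        (mem_orthogonal_of_starProjection_mem_kyFanFace hG hg hP hkj hj) _ (b i).2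
  · beta_reduce
    rw [hb i hi]
    exact hG (Fin.castLE hkn i)

end KyFanFace

section FunctionalCalculus

theorem continuous_rpow_of_nonneg {𝓐 X : Type*} [CStarAlgebra 𝓐] [PartialOrder 𝓐]
    [StarOrderedRing 𝓐] [TopologicalSpace X] {a : X → 𝓐} (ha : Continuous a) (ha0 : ∀ t, 0 ≤ a t)
    {s : ℝ} (hs : 0 ≤ s) : Continuous fun t => a t ^ s := by
  simp only [CFC.rpow_def]
  exact Continuous.cfc_nnreal_of_mem_nhdsSet _ Filter.univ_mem ha ha0
    (NNReal.continuous_rpow_const hs).continuousOn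

variable {E : Type*} [NormedAddCommGroup E] [InnerProductSpace ℂ E] [FiniteDimensional ℂ E]

theorem finite_spectrum_real (a : E →L[ℂ] E) : (spectrum ℝ a).Finite := by
  have h : (spectrum ℂ a).Finite := by
    rw [← AlgEquiv.spectrum_eq (Module.End.toContinuousLinearMap E).symm a]
    exact Module.End.finite_spectrum _
  rw [← spectrum.preimage_algebraMap ℂ]
  exact h.preimage (FaithfulSMul.algebraMap_injective ℝ ℂ).injOn

variable [CompleteSpace E] {a : E →L[ℂ] E} {x : E} {μ : ℝ}

theorem cfc_apply_of_apply_eq_smul (ha : IsSelfAdjoint a) (f : ℝ → ℝ)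
    (h : a x = (μ : ℂ) • x) : cfc f a x = (f μ : ℂ) • x := by
  have hcont (φ : ℝ → ℝ) : ContinuousOn φ (spectrum ℝ a) := (finite_spectrum_real a).continuousOn φ
  have hf : f = fun t => dslope f μ t * (t - μ) + f μ := by
    funext t
    rw [mul_comm, ← smul_eq_mul, sub_smul_dslope, sub_add_cancel]
  have hcfc : cfc f a = cfc (dslope f μ) a * (a - algebraMap ℝ _ μ) + algebraMap ℝ _ (f μ) := by
    conv_lhs => rw [hf]
    rw [cfc_add_const _ _ _ (hcont _), cfc_mul _ _ _ (hcont _), cfc_sub .., cfc_id' ..,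
      cfc_const ..]
  rw [hcfc, add_apply, mul_apply_eq_comp, sub_apply, h, Algebra.algebraMap_eq_smul_one,
    Algebra.algebraMap_eq_smul_one, smul_apply, smul_apply, one_apply_eq_self, Complex.coe_smul,
    sub_self, map_zero, zero_add, Complex.coe_smul]

theorem rpow_apply_of_apply_eq_smul (ha : 0 ≤ a) (s : ℝ)
    (h : a x = (μ : ℂ) • x) : (a ^ s) x = ((μ ^ s : ℝ) : ℂ) • x := by
  rw [CFC.rpow_eq_cfc_real ha]
  exact cfc_apply_of_apply_eq_smul (.of_nonneg ha) (fun t => t ^ s) h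

end FunctionalCalculus

section SingularFrames

variable {E F : Type*} [NormedAddCommGroup E] [InnerProductSpace ℂ E] [CompleteSpace E]
  [NormedAddCommGroup F] [InnerProductSpace ℂ F] [CompleteSpace F]

variable {T : E →L[ℂ] F} {v : E} {σ p : ℝ}

theorem adjoint_comp_self_nonneg (T : E →L[ℂ] F) : 0 ≤ T† ∘L T :=
  (ContinuousLinearMap.nonneg_iff_isPositive _).2 T.isPositive_adjoint_comp_self

theorem norm_map_eq_of_adjoint_comp_self_apply (hσ : 0 ≤ σ) (hv : ‖v‖ = 1)
    (h : (T† ∘L T) v = ((σ ^ 2 : ℝ) : ℂ) • v) : ‖T v‖ = σ := by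
  rw [← sq_eq_sq₀ (norm_nonneg _) hσ, ContinuousLinearMap.apply_norm_sq_eq_inner_adjoint_right, h,
    inner_smul_right, RCLike.re_to_complex, Complex.re_ofReal_mul, ← RCLike.re_to_complex,
    inner_self_eq_norm_sq, hv, one_pow, mul_one]

variable [FiniteDimensional ℂ E]

theorem rpow_re_inner_map_self_le {a : E →L[ℂ] E} (ha : 0 ≤ a) {x : E} (hx : ‖x‖ = 1) {q : ℝ}
    (hq : 1 ≤ q) : (⟪x, a x⟫_ℂ).re ^ q ≤ (⟪x, (a ^ q) x⟫_ℂ).re := by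
  have hpos := (ContinuousLinearMap.nonneg_iff_isPositive a).1 ha
  set u := hpos.isSymmetric.eigenvectorBasis rfl
  set h := hpos.isSymmetric.eigenvalues rfl
  have hu (j) : a (u j) = (h j : ℂ) • u j := hpos.isSymmetric.apply_eigenvectorBasis rfl j
  have hnonneg (j) : 0 ≤ h j := by
    rw [eigenvalue_eq_re_inner hu]
    exact hpos.re_inner_nonneg_right (u j)
  rw [re_inner_map_self_eq_sum hu,
    re_inner_map_self_eq_sum fun j => rpow_apply_of_apply_eq_smul ha q (hu j)]
  simp only [mul_comm (_ : ℝ) (‖_‖ ^ 2)]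
  refine Real.rpow_arith_mean_le_arith_mean_rpow _ _ _ (fun j _ => sq_nonneg _) ?_
    (fun j _ => hnonneg j) hq
  rw [u.sum_sq_norm_inner_right, hx, one_pow]

theorem norm_map_rpow_le (hp : 2 ≤ p) (hv : ‖v‖ = 1) :
    ‖T v‖ ^ p ≤ (⟪v, ((T† ∘L T) ^ (p / 2)) v⟫_ℂ).re := by
  refine le_of_eq_of_le ?_
    (rpow_re_inner_map_self_le (adjoint_comp_self_nonneg T) hv (by linarith : 1 ≤ p / 2))
  rw [← RCLike.re_to_complex, ← ContinuousLinearMap.apply_norm_sq_eq_inner_adjoint_right,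
    ← Real.rpow_natCast_mul (norm_nonneg _), Nat.cast_ofNat, mul_div_cancel₀ p two_ne_zero]

theorem rpow_adjoint_comp_self_apply (hσ : 0 ≤ σ) (h : (T† ∘L T) v = ((σ ^ 2 : ℝ) : ℂ) • v)
    (s : ℝ) : ((T† ∘L T) ^ (s / 2)) v = ((σ ^ s : ℝ) : ℂ) • v := by
  rw [rpow_apply_of_apply_eq_smul (adjoint_comp_self_nonneg T) _ h, ← Real.rpow_natCast_mul hσ,
    Nat.cast_ofNat, mul_div_cancel₀ s two_ne_zero]

variable [FiniteDimensional ℂ F]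

/-- An orthonormal basis of right singular vectors, listed by non-increasing singular value. -/
noncomputable def rightSingularBasis (T : E →L[ℂ] F) :
    OrthonormalBasis (Fin (Module.finrank ℂ E)) ℂ E :=
  (T : E →ₗ[ℂ] F).isSymmetric_adjoint_comp_self.eigenvectorBasis rfl

theorem adjoint_comp_self_rightSingularBasis (T : E →L[ℂ] F) (j : Fin (Module.finrank ℂ E)) :
    (T† ∘L T) (rightSingularBasis T j) =
      (((T : E →ₗ[ℂ] F).singularValues j ^ 2 : ℝ) : ℂ) • rightSingularBasis T j := by
  rw [(T : E →ₗ[ℂ] F).sq_singularValues_fin rfl]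
  exact (T : E →ₗ[ℂ] F).isSymmetric_adjoint_comp_self.apply_eigenvectorBasis rfl j

theorem sum_norm_map_rpow_le (hp : 2 ≤ p) {k : ℕ} {v : Fin k → E} (hv : Orthonormal ℂ v) :
    ∑ i, ‖T (v i)‖ ^ p ≤ ∑ i ∈ Finset.range k, (T : E →ₗ[ℂ] F).singularValues i ^ p := by
  calc ∑ i, ‖T (v i)‖ ^ p
      ≤ ∑ i, (⟪v i, ((T† ∘L T) ^ (p / 2)) (v i)⟫_ℂ).re :=
        Finset.sum_le_sum fun i _ => norm_map_rpow_le hp (hv.1 i)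
    _ = (traceMul ((T† ∘L T) ^ (p / 2)) (frameProjection v)).re := by
        rw [traceMul_frameProjection, Complex.re_sum]
    _ ≤ ∑ i ∈ Finset.range k, (T : E →ₗ[ℂ] F).singularValues i ^ p :=
        re_traceMul_le_sum_range (e := rightSingularBasis T)
          (fun j => rpow_adjoint_comp_self_apply (LinearMap.singularValues_nonneg _ _)
            (adjoint_comp_self_rightSingularBasis T j) p)
          (fun _ _ hij => Real.rpow_le_rpow (LinearMap.singularValues_nonneg _ _)
            (LinearMap.singularValues_antitone _ hij) (by linarith))
          (frameProjection_mem_fractionalProjections hv)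

end SingularFrames

section PowGradient

variable {E F : Type*} [NormedAddCommGroup E] [InnerProductSpace ℂ E] [CompleteSpace E]
  [NormedAddCommGroup F] [InnerProductSpace ℂ F] [CompleteSpace F]

/-- The operator `(T†T)^((p-2)/2) T†`. It represents the derivative of `T ↦ tr (T†T)^(p/2)`, which
is `C ↦ p * re tr (powGradient p T ∘L C)`. -/
noncomputable def powGradient (p : ℝ) (T : E →L[ℂ] F) : F →L[ℂ] E :=
  ((T† ∘L T) ^ ((p - 2) / 2)) ∘L T†

theorem continuous_powGradient {p : ℝ} (hp : 2 ≤ p) :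
    Continuous (powGradient p : (E →L[ℂ] F) → F →L[ℂ] E) := by
  have hadj : Continuous fun T : E →L[ℂ] F => T† := ContinuousLinearMap.adjoint.continuous
  exact (continuous_rpow_of_nonneg (hadj.clm_comp continuous_id) adjoint_comp_self_nonneg
    (by linarith)).clm_comp hadj

end PowGradient

section KyFan

variable {E F : Type*} [NormedAddCommGroup E] [InnerProductSpace ℂ E] [FiniteDimensional ℂ E]
  [NormedAddCommGroup F] [InnerProductSpace ℂ F] [FiniteDimensional ℂ F]

/-- The sum of the `p`-th powers of the `k` largest singular values, i.e. the `p`-th power of the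
Ky Fan `p`-`k` norm. -/
noncomputable def kyFanPowSum (p : ℝ) (k : ℕ) (T : E →L[ℂ] F) : ℝ :=
  ∑ i ∈ Finset.range k, (T : E →ₗ[ℂ] F).singularValues i ^ p

theorem antitone_sq_singularValues (T : E →L[ℂ] F) :
    Antitone fun i => (T : E →ₗ[ℂ] F).singularValues i ^ 2 := fun _ _ hij =>
  pow_le_pow_left₀ (LinearMap.singularValues_nonneg _ _) (LinearMap.singularValues_antitone _ hij) 2

variable [CompleteSpace E] [CompleteSpace F] {T S : E →L[ℂ] F} {p : ℝ} {k : ℕ}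

/-- An orthonormal family of right singular vectors of `T` for its `k` largest singular values. -/
structure IsRightSingularFrame (T : E →L[ℂ] F) (v : Fin k → E) : Prop where
  orthonormal : Orthonormal ℂ v
  adjoint_comp_self_apply (i : Fin k) :
    (T† ∘L T) (v i) = (((T : E →ₗ[ℂ] F).singularValues i ^ 2 : ℝ) : ℂ) • v i

theorem isRightSingularFrame_rightSingularBasis (T : E →L[ℂ] F) (hk : k ≤ Module.finrank ℂ E) :
    IsRightSingularFrame T (rightSingularBasis T ∘ Fin.castLE hk) where
  orthonormal := (rightSingularBasis T).orthonormal.comp _ (Fin.castLE_injective hk)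
  adjoint_comp_self_apply i := adjoint_comp_self_rightSingularBasis T (Fin.castLE hk i)

theorem exists_isRightSingularFrame_eq_frameProjection {P : E →L[ℂ] E}
    (hP : P ∈ kyFanFace (T† ∘L T) k) (hPi : IsIdempotentElem P) :
    ∃ v : Fin k → E, IsRightSingularFrame T v ∧ P = frameProjection v := by
  obtain ⟨v, hv, hTv, hPv⟩ := exists_orthonormal_eq_frameProjection
    (adjoint_comp_self_rightSingularBasis T) (antitone_sq_singularValues T) hP hPi
  exact ⟨v, ⟨hv, hTv⟩, hPv⟩

namespace IsRightSingularFrame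

variable {v : Fin k → E} (hv : IsRightSingularFrame T v)

include hv

theorem norm_map (i : Fin k) : ‖T (v i)‖ = (T : E →ₗ[ℂ] F).singularValues i :=
  norm_map_eq_of_adjoint_comp_self_apply (LinearMap.singularValues_nonneg _ _) (hv.orthonormal.1 i)
    (hv.adjoint_comp_self_apply i)

theorem frameProjection_mem_kyFanFace : frameProjection v ∈ kyFanFace (T† ∘L T) k :=
  mem_kyFanFace_of_sum_range_le (adjoint_comp_self_rightSingularBasis T)
    (antitone_sq_singularValues T) (frameProjection_mem_fractionalProjections hv.orthonormal)
    (re_traceMul_frameProjection hv.orthonormal hv.adjoint_comp_self_apply).ge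

theorem inner_powGradient (i : Fin k) (y : F) :
    ⟪v i, powGradient p T y⟫_ℂ = ((‖T (v i)‖ ^ (p - 2) : ℝ) : ℂ) * ⟪T (v i), y⟫_ℂ := by
  have hsa : IsSelfAdjoint ((T† ∘L T) ^ ((p - 2) / 2)) := .of_nonneg CFC.rpow_nonneg
  rw [powGradient, ContinuousLinearMap.comp_apply, ← hsa.isSymmetric.apply_clm,
    rpow_adjoint_comp_self_apply (LinearMap.singularValues_nonneg _ _)
      (hv.adjoint_comp_self_apply i), inner_smul_left, Complex.conj_ofReal,
    ContinuousLinearMap.adjoint_inner_right, hv.norm_map]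

theorem re_traceMul_powGradient_comp (p : ℝ) (S : E →L[ℂ] F) :
    (traceMul (powGradient p T ∘L S) (frameProjection v)).re =
      ∑ i, ‖T (v i)‖ ^ (p - 2) * (⟪T (v i), S (v i)⟫_ℂ).re := by
  simp only [traceMul_frameProjection, ContinuousLinearMap.comp_apply, hv.inner_powGradient,
    Complex.re_sum, Complex.re_ofReal_mul]

theorem sum_norm_map_rpow (p : ℝ) : ∑ i, ‖T (v i)‖ ^ p = kyFanPowSum p k T := by
  simp only [hv.norm_map, kyFanPowSum, Finset.sum_range]

theorem re_traceMul_powGradient_comp_self (hp : p ≠ 0) :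
    (traceMul (powGradient p T ∘L T) (frameProjection v)).re = kyFanPowSum p k T := by
  rw [hv.re_traceMul_powGradient_comp, ← hv.sum_norm_map_rpow]
  exact Finset.sum_congr rfl fun i _ => norm_rpow_sub_two_mul_re_inner_self (𝕜 := ℂ) hp (T (v i))

theorem re_traceMul_powGradient_comp_le (hp : 2 ≤ p) (S : E →L[ℂ] F) :
    (traceMul (powGradient p T ∘L S) (frameProjection v)).re ≤
      (1 - 1 / p) * kyFanPowSum p k T + 1 / p * kyFanPowSum p k S := by
  calc (traceMul (powGradient p T ∘L S) (frameProjection v)).re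
      ≤ ∑ i, ((1 - 1 / p) * ‖T (v i)‖ ^ p + 1 / p * ‖S (v i)‖ ^ p) := by
        rw [hv.re_traceMul_powGradient_comp]
        exact Finset.sum_le_sum fun i _ =>
          norm_rpow_sub_two_mul_re_inner_le (𝕜 := ℂ) (by linarith) (T (v i)) (S (v i))
    _ = (1 - 1 / p) * kyFanPowSum p k T + 1 / p * ∑ i, ‖S (v i)‖ ^ p := by
        rw [Finset.sum_add_distrib, ← Finset.mul_sum, ← Finset.mul_sum, hv.sum_norm_map_rpow]
    _ ≤ (1 - 1 / p) * kyFanPowSum p k T + 1 / p * kyFanPowSum p k S := by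
        gcongr
        exact sum_norm_map_rpow_le hp hv.orthonormal

theorem kyFanPowSum_le_add_smul (hp : 2 ≤ p)
    (h0 : traceMul (powGradient p T ∘L S) (frameProjection v) = 0) (z : ℂ) :
    kyFanPowSum p k T ≤ kyFanPowSum p k (T + z • S) := by
  have hself := hv.re_traceMul_powGradient_comp_self (by linarith : p ≠ 0)
  have hle := hv.re_traceMul_powGradient_comp_le hp (T + z • S)
  rw [traceMul_comp_add_smul, h0, mul_zero, add_zero, hself] at hle
  have hp0 : 0 < 1 / p := by positivity
  exact le_of_mul_le_mul_left (by linarith) hp0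

end IsRightSingularFrame

theorem IsRightSingularFrame.re_mul_traceMul_powGradient_comp_nonneg {v : Fin k → E} {z : ℂ}
    {t : ℝ} (hp : 2 ≤ p) (ht : 0 < t)
    (hv : IsRightSingularFrame (T + (t * z) • S) v)
    (h : kyFanPowSum p k T ≤ kyFanPowSum p k (T + (t * z) • S)) :
    0 ≤ (z * traceMul (powGradient p (T + (t * z) • S) ∘L S) (frameProjection v)).re := by
  have hself := hv.re_traceMul_powGradient_comp_self (by linarith : p ≠ 0)
  have hle := hv.re_traceMul_powGradient_comp_le hp T
  set X := T + (t * z) • S with hX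
  rw [hX, traceMul_comp_add_smul, ← hX, Complex.add_re, mul_assoc, Complex.re_ofReal_mul] at hself
  refine nonneg_of_mul_nonneg_right (a := t) ?_ ht
  have hmul : 1 / p * kyFanPowSum p k T ≤ 1 / p * kyFanPowSum p k X := by gcongr
  linarith

theorem exists_mem_kyFanFace_re_mul_traceMul_nonneg (hp : 2 ≤ p) (hk : k ≤ Module.finrank ℂ E)
    (h : ∀ z : ℂ, kyFanPowSum p k T ≤ kyFanPowSum p k (T + z • S)) (z : ℂ) :
    ∃ H ∈ kyFanFace (T† ∘L T) k, 0 ≤ (z * traceMul (powGradient p T ∘L S) H).re := by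
  let t (l : ℕ) : ℝ := 1 / ((l : ℝ) + 1)
  let X (l : ℕ) : E →L[ℂ] F := T + (t l * z) • S
  have hframe (l : ℕ) := isRightSingularFrame_rightSingularBasis (X l) hk
  obtain ⟨H, -, φ, hφ, hPφ⟩ := isCompact_fractionalProjections.tendsto_subseq fun l =>
    (hframe l).frameProjection_mem_kyFanFace.1
  have hX : Tendsto (X ∘ φ) atTop (𝓝 T) := by
    have ht : Tendsto (fun l => (t l : ℂ)) atTop (𝓝 (0 : ℝ)) :=
      (Complex.continuous_ofReal.tendsto 0).comp tendsto_one_div_add_atTop_nhds_zero_nat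
    simpa [X, Function.comp_def] using
      (((ht.comp hφ.tendsto_atTop).mul_const z).smul_const S).const_add T
  have hφS : Tendsto (fun l => powGradient p (X (φ l)) ∘L S) atTop
      (𝓝 (powGradient p T ∘L S)) :=
    (((continuous_powGradient hp).clm_comp continuous_const).tendsto T).comp hX
  have hgram : Tendsto (fun l => (X (φ l))† ∘L X (φ l)) atTop (𝓝 (T† ∘L T)) :=
    ((ContinuousLinearMap.adjoint.continuous.clm_comp continuous_id).tendsto T).comp hX
  refine ⟨H, mem_kyFanFace_of_tendsto hgram hPφ fun l =>
    (hframe (φ l)).frameProjection_mem_kyFanFace, ?_⟩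
  refine ge_of_tendsto' ((Complex.continuous_re.tendsto _).comp
    ((tendsto_traceMul hφS hPφ).const_mul z)) fun l => ?_
  exact (hframe (φ l)).re_mul_traceMul_powGradient_comp_nonneg hp Nat.one_div_pos_of_nat (h _)

theorem exists_isRightSingularFrame_traceMul_eq_zero (hp : 2 ≤ p) (hk : k ≤ Module.finrank ℂ E)
    (h : ∀ z : ℂ, kyFanPowSum p k T ≤ kyFanPowSum p k (T + z • S)) :
    ∃ v : Fin k → E, IsRightSingularFrame T v ∧
      traceMul (powGradient p T ∘L S) (frameProjection v) = 0 := by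
  have hface := isExposed_kyFanFace (T† ∘L T) k
  have hcomp := hface.isCompact isCompact_fractionalProjections
  set Λ := traceMul (powGradient p T ∘L S)
  obtain ⟨H, hH, hH0⟩ : (0 : ℂ) ∈ Λ '' kyFanFace (T† ∘L T) k := by
    refine zero_mem_of_forall_exists_re_mul_nonneg
      ((hface.convex convex_fractionalProjections).linear_image (Λ.toLinearMap.restrictScalars ℝ))
      (hcomp.image Λ.continuous).isClosed fun z => ?_
    obtain ⟨H, hH, hnonneg⟩ := exists_mem_kyFanFace_re_mul_traceMul_nonneg hp hk h z
    exact ⟨Λ H, ⟨H, hH, rfl⟩, hnonneg⟩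
  obtain ⟨P, hP, hPi, hPH⟩ := exists_isIdempotentElem_traceMul_eq hface.isExtreme hcomp _ hH
  obtain ⟨v, hv, rfl⟩ := exists_isRightSingularFrame_eq_frameProjection hP hPi
  exact ⟨v, hv, hPH.trans hH0⟩

end KyFan

section OperatorNorm

variable {E F : Type*} [NormedAddCommGroup E] [InnerProductSpace ℂ E] [FiniteDimensional ℂ E]
  [NormedAddCommGroup F] [InnerProductSpace ℂ F] [FiniteDimensional ℂ F] {p : ℝ} {k : ℕ}

/-- The Ky Fan `p`-`k` norm of an operator between finite-dimensional inner product spaces. -/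
noncomputable def operatorKyFanNorm (p : ℝ) (k : ℕ) (T : E →L[ℂ] F) : ℝ :=
  kyFanPowSum p k T ^ (1 / p)

theorem kyFanPowSum_nonneg (T : E →L[ℂ] F) : 0 ≤ kyFanPowSum p k T :=
  Finset.sum_nonneg fun _ _ => Real.rpow_nonneg (LinearMap.singularValues_nonneg _ _) p

theorem operatorKyFanNorm_le_iff (hp : 0 < p) {T S : E →L[ℂ] F} :
    operatorKyFanNorm p k T ≤ operatorKyFanNorm p k S ↔ kyFanPowSum p k T ≤ kyFanPowSum p k S :=
  Real.rpow_le_rpow_iff (kyFanPowSum_nonneg T) (kyFanPowSum_nonneg S) (one_div_pos.2 hp)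

theorem mainTheorem6_general [CompleteSpace E] [CompleteSpace F] (hp : 2 ≤ p)
    (hk : k ≤ Module.finrank ℂ E) (T S : E →L[ℂ] F) :
    (∀ z : ℂ, operatorKyFanNorm p k T ≤ operatorKyFanNorm p k (T + z • S)) ↔
      ∃ v : Fin k → E, IsRightSingularFrame T v ∧
        ∑ i, ⟪v i, powGradient p T (S (v i))⟫_ℂ = 0 := by
  simp only [operatorKyFanNorm_le_iff (by linarith : 0 < p)]
  constructor
  · intro h
    obtain ⟨v, hv, h0⟩ := exists_isRightSingularFrame_traceMul_eq_zero hp hk h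
    exact ⟨v, hv, (traceMul_frameProjection _ v).symm.trans h0⟩
  · rintro ⟨v, hv, h0⟩
    exact hv.kyFanPowSum_le_add_smul hp ((traceMul_frameProjection _ v).trans h0)

end OperatorNorm

section Matrix

variable {m n : ℕ}

/-- The operator between Euclidean spaces with matrix `A`. -/
noncomputable def euclideanOperator (A : Matrix (Fin m) (Fin n) ℂ) :
    EuclideanSpace ℂ (Fin n) →L[ℂ] EuclideanSpace ℂ (Fin m) :=
  (Matrix.toEuclideanLin A).toContinuousLinearMap

theorem adjoint_euclideanOperator (A : Matrix (Fin m) (Fin n) ℂ) :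
    (euclideanOperator A)† = euclideanOperator Aᴴ := by
  refine ContinuousLinearMap.coe_injective ?_
  exact (Matrix.toEuclideanLin_conjTranspose_eq_adjoint A).symm

theorem euclideanOperator_comp {l : ℕ} (A : Matrix (Fin l) (Fin m) ℂ)
    (B : Matrix (Fin m) (Fin n) ℂ) :
    euclideanOperator A ∘L euclideanOperator B = euclideanOperator (A * B) :=
  ContinuousLinearMap.coe_injective (Matrix.toLpLin_mul 2 2 2 A B).symm

theorem euclideanOperator_add_smul (A B : Matrix (Fin m) (Fin n) ℂ) (z : ℂ) :
    euclideanOperator (A + z • B) = euclideanOperator A + z • euclideanOperator B := by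
  simp only [euclideanOperator, map_add, map_smul]

theorem euclideanOperator_rpow {M : Matrix (Fin n) (Fin n) ℂ} (hM : 0 ≤ M) (s : ℝ) :
    euclideanOperator (M ^ s) = euclideanOperator M ^ s := by
  let Φ := Matrix.toEuclideanCLM (n := Fin n) (𝕜 := ℂ)
  have hΦ : Continuous Φ := Φ.toAlgEquiv.toLinearMap.continuous_of_finiteDimensional
  have hΦM : 0 ≤ Φ M := map_nonneg Φ hM
  change Φ (M ^ s) = Φ M ^ s
  rw [CFC.rpow_eq_cfc_real hM, CFC.rpow_eq_cfc_real hΦM]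
  exact StarAlgHomClass.map_cfc (S := ℂ) Φ _ M (Matrix.finite_real_spectrum.continuousOn _) hΦ

open scoped ComplexOrder in
theorem powGradient_euclideanOperator (p : ℝ) (A : Matrix (Fin m) (Fin n) ℂ) :
    powGradient p (euclideanOperator A) = euclideanOperator ((Aᴴ * A) ^ ((p - 2) / 2) * Aᴴ) := by
  have hA : 0 ≤ Aᴴ * A := (Matrix.posSemidef_conjTranspose_mul_self A).nonneg
  rw [powGradient, adjoint_euclideanOperator, euclideanOperator_comp, ← euclideanOperator_rpow hA,
    euclideanOperator_comp]

theorem operatorKyFanNorm_euclideanOperator (p : ℝ) (k : ℕ) (A : Matrix (Fin m) (Fin n) ℂ) :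
    operatorKyFanNorm p k (euclideanOperator A) = kyFanNorm p k A := rfl

theorem isRightSingularFrame_euclideanOperator_iff {k : ℕ} {A : Matrix (Fin m) (Fin n) ℂ}
    {v : Fin k → EuclideanSpace ℂ (Fin n)} :
    IsRightSingularFrame (euclideanOperator A) v ↔ Orthonormal ℂ v ∧
      ∀ i : Fin k, Matrix.toEuclideanLin (Aᴴ * A) (v i) =
        ((matrixSingularValue A i ^ 2 : ℝ) : ℂ) • v i := by
  have hgram : (euclideanOperator A)† ∘L euclideanOperator A = euclideanOperator (Aᴴ * A) := by
    rw [adjoint_euclideanOperator, euclideanOperator_comp]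
  constructor
  · rintro ⟨horth, heig⟩
    rw [hgram] at heig
    exact ⟨horth, heig⟩
  · rintro ⟨horth, heig⟩
    exact ⟨horth, by rw [hgram]; exact heig⟩

theorem inner_powGradient_euclideanOperator (p : ℝ) (A B : Matrix (Fin m) (Fin n) ℂ)
    (x y : EuclideanSpace ℂ (Fin n)) :
    ⟪x, powGradient p (euclideanOperator A) (euclideanOperator B y)⟫_ℂ =
      ⟪x, Matrix.toEuclideanLin ((Aᴴ * A) ^ ((p - 2) / 2) * Aᴴ * B) y⟫_ℂ := by
  rw [powGradient_euclideanOperator, ← ContinuousLinearMap.comp_apply, euclideanOperator_comp]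
  rfl

end Matrix

theorem mainTheorem6 (m n : ℕ) (p : ℝ) (hp : 2 ≤ p) (k : ℕ) (hk : 1 ≤ k) (hkn : k ≤ n)
    (A B : Matrix (Fin m) (Fin n) ℂ) :
    KyFanBirkhoffJamesOrthogonal p k A B ↔
      ∃ v : Fin k → EuclideanSpace ℂ (Fin n),
        Orthonormal ℂ v ∧
        (∀ i : Fin k, Matrix.toEuclideanLin (Aᴴ * A) (v i) =
          ((matrixSingularValue A i ^ 2 : ℝ) : ℂ) • v i) ∧
        ∑ i : Fin k,
          inner ℂ (v i) (Matrix.toEuclideanLin ((Aᴴ * A) ^ ((p - 2) / 2) * Aᴴ * B) (v i)) = 0 := by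
  simpa only [KyFanBirkhoffJamesOrthogonal, operatorKyFanNorm_euclideanOperator,
    ← euclideanOperator_add_smul, isRightSingularFrame_euclideanOperator_iff,
    inner_powGradient_euclideanOperator, and_assoc] using
    mainTheorem6_general hp (by simpa using hkn) (euclideanOperator A) (euclideanOperator B)
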